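/- Let $\mathbb{N}=\{1,2,\dots\}$. For $S\subset\mathbb{N}$ let $\mu^*(S)$ be the infimum of $\sum_{k=1}^r 1/m_k$ over all finite families of arithmetic progressions $a_k+(m_k)=\{x\in\mathbb{N}: x\equiv a_k \bmod m_k\}$ ($a_k\ge 0$, $m_k\ge 1$) that cover $S$; $S$ is Buck measurable if $\mu^*(S)+\mu^*(\mathbb{N}\setminus S)=1$. Let $\mathbb{X}$ be a set and, for $n=1,2,\dots$, let $\mathcal{E}_n=\{A^{(n)}_1,\dots,A^{(n)}_{k_n}\}$ be a finite decomposition of $\mathbb{X}$ into pairwise disjoint sets, such that (i) for any finitely many sets $A^{(j_1)}_{h_1},\dots,A^{(j_m)}_{h_m}$ there is an $s$ such that each of them is a union of sets of $\mathcal{E}_s$, and (ii) for every sequence of indices $(h_n)$ the intersection $\bigcap_{n\ge 1} A^{(n)}_{h_n}$ has at most one element. Let $\mathcal{D}_0$ be the algebra of all finite unions of sets $A^{(n)}_i$, and let $\Delta:\mathcal{D}_0\to[0,1]$ be a finitely additive probability measure. Put $\nu^*(S)=\inf\{\Delta(A): A\in\mathcal{D}_0,\ S\subset A\}$ for $S\subset\mathbb{X}$,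 and call $S$ $\nu^*$-measurable if $\nu^*(S)+\nu^*(\mathbb{X}\setminus S)=1$. Let $\rho(x,y)=\sum_{n\ge 1}\psi_n(x,y)/2^n$, where $\psi_n(x,y)=0$ if $x,y$ belong to the same set of $\mathcal{E}_n$ and $\psi_n(x,y)=1$ otherwise; this is a metric on $\mathbb{X}$. A sequence $(x_n)_{n\ge 1}$ in $\mathbb{X}$ is called $\nu^*$-Buck uniformly distributed ($\nu^*$-B.u.d.) if for every $\nu^*$-measurable $S\subset\mathbb{X}$ the set $\{n\in\mathbb{N}: x_n\in S\}$ is Buck measurable and $\mu^*(\{n: x_n\in S\})=\nu^*(S)$. A bijection $g:\mathbb{X}\to\mathbb{X}$ is said to preserve the measure density if for every $\nu^*$-measurable $S$ the set $g(S)$ is $\nu^*$-measurable and $\nu^*(g(S))=\nu^*(S)$. **Theorem.** Let $g:\mathbb{X}\to\mathbb{X}$ be a bijection such that $g^{-1}$ is uniformly continuous with respect to the metric $\rho$. Then $g$ preserves the measure density if and only if there exists at least one $\nu^*$-B.u.d. sequence $(x_n)_{n\ge 1}$ such that $(g^{-1}(x_n))_{n\ge 1}$ is also $\nu^*$-B.u.d.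 -/

import Mathlib

open scoped NNReal

noncomputable section

/-- The arithmetic progression `a + (m) = {x ∈ ℕ : x ≡ a (mod m)}` of positive integers. -/
def arithProg (a : ℕ) (m : ℕ+) : Set ℕ+ :=
  {x : ℕ+ | (x : ℕ) ≡ a [MOD (m : ℕ)]}

/-- Buck's measure density `μ*` of a set of positive integers. -/
def buckDensity (S : Set ℕ+) : ℝ :=
  sInf {r : ℝ | ∃ (n : ℕ) (a : Fin n → ℕ) (m : Fin n → ℕ+),
    S ⊆ ⋃ k, arithProg (a k) (m k) ∧ r = ∑ k, 1 / ((m k : ℕ) : ℝ)}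

/-- Buck measurable sets of positive integers. -/
def BuckMeasurable (S : Set ℕ+) : Prop :=
  buckDensity S + buckDensity Sᶜ = 1

/-- A sequence `𝓔_1, 𝓔_2, …` of finite decompositions `𝓔_n = {A_1^{(n)}, …, A_{k_n}^{(n)}}`
of `X` into disjoint sets, satisfying the two standing conditions. -/
structure DecompositionSystem (X : Type*) where
  /-- the number `k_n` of sets of the `n`-th decomposition -/
  size : ℕ+ → ℕ
  /-- the sets `A_i^{(n)}` -/
  cell : (n : ℕ+) → Fin (size n) → Set X
  disjoint : ∀ n i j, i ≠ j → cell n i ∩ cell n j = ∅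
  cover : ∀ n, ⋃ i, cell n i = Set.univ
  /-- finitely many cells are all unions of cells of a single decomposition `𝓔_s` -/
  refinement : ∀ F : Finset (Σ n : ℕ+, Fin (size n)), ∃ s : ℕ+, ∀ p ∈ F,
    ∃ T : Finset (Fin (size s)), cell p.1 p.2 = ⋃ i ∈ T, cell s i
  /-- the intersection of one cell from each decomposition has at most one element -/
  separate : ∀ h : (n : ℕ+) → Fin (size n), (⋂ n, cell n (h n)).Subsingleton

namespace DecompositionSystem

variable {X : Type*} (D : DecompositionSystem X)

/-- The algebra `𝓓_0` of all finite unions of cells. -/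
def algebra : Set (Set X) :=
  {S | ∃ F : Finset (Σ n : ℕ+, Fin (D.size n)), S = ⋃ p ∈ F, D.cell p.1 p.2}

/-- `x` and `y` belong to the same set of the `n`-th decomposition. -/
def SameCell (n : ℕ+) (x y : X) : Prop :=
  ∃ i, x ∈ D.cell n i ∧ y ∈ D.cell n i

open Classical in
/-- `ψ_n(x, y)` is `0` if `x, y` lie in the same set of `𝓔_n`, and `1` otherwise. -/
def psi (n : ℕ+) (x y : X) : ℝ :=
  if D.SameCell n x y then 0 else 1

/-- `ρ(x, y) = ∑_{n ≥ 1} ψ_n(x, y) / 2^n`. -/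
def rho (x y : X) : ℝ :=
  ∑' n : ℕ+, D.psi n x y / 2 ^ (n : ℕ)

theorem exists_cell (n : ℕ+) (x : X) : ∃ i, x ∈ D.cell n i := by
  have h : x ∈ ⋃ i, D.cell n i := by rw [D.cover n]; trivial
  simpa using h

theorem SameCell.trans' {n : ℕ+} {x y z : X} (h₁ : D.SameCell n x y) (h₂ : D.SameCell n y z) :
    D.SameCell n x z := by
  obtain ⟨i, hx, hy⟩ := h₁
  obtain ⟨j, hy', hz⟩ := h₂
  have hij : i = j := by
    by_contra hne
    have : y ∈ D.cell n i ∩ D.cell n j := ⟨hy, hy'⟩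
    rw [D.disjoint n i j hne] at this
    exact this
  subst hij
  exact ⟨i, hx, hz⟩

theorem psi_nonneg (n : ℕ+) (x y : X) : 0 ≤ D.psi n x y := by
  unfold psi; split_ifs <;> norm_num

theorem psi_le_one (n : ℕ+) (x y : X) : D.psi n x y ≤ 1 := by
  unfold psi; split_ifs <;> norm_num

theorem summable_rho (x y : X) : Summable fun n : ℕ+ => D.psi n x y / 2 ^ (n : ℕ) := by
  have hg : Summable fun n : ℕ+ => ((1 : ℝ) / 2) ^ (n : ℕ) :=
    summable_geometric_two.comp_injective PNat.coe_injective
  refine Summable.of_nonneg_of_le (fun n => div_nonneg (D.psi_nonneg n x y) (by positivity))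
    (fun n => ?_) hg
  rw [one_div, inv_pow, div_eq_mul_inv]
  exact mul_le_of_le_one_left (by positivity) (D.psi_le_one n x y)

theorem rho_self (x : X) : D.rho x x = 0 := by
  have h : ∀ n, D.psi n x x = 0 := fun n => by
    obtain ⟨i, hi⟩ := D.exists_cell n x
    exact if_pos ⟨i, hi, hi⟩
  simp [rho, h]

theorem rho_comm (x y : X) : D.rho x y = D.rho y x := by
  have h : ∀ n, D.psi n x y = D.psi n y x := fun n => by
    have : D.SameCell n x y ↔ D.SameCell n y x := by
      simp only [SameCell, and_comm]
    by_cases h : D.SameCell n x y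
    · rw [psi, psi, if_pos h, if_pos (this.1 h)]
    · rw [psi, psi, if_neg h, if_neg (fun h' => h (this.2 h'))]
  simp [rho, h]

theorem rho_triangle (x y z : X) : D.rho x z ≤ D.rho x y + D.rho y z := by
  unfold rho
  rw [← (D.summable_rho x y).tsum_add (D.summable_rho y z)]
  refine (D.summable_rho x z).tsum_le_tsum (fun n => ?_)
    ((D.summable_rho x y).add (D.summable_rho y z))
  rw [← add_div]
  refine div_le_div_of_nonneg_right ?_ (by positivity)
  by_cases h₁ : D.SameCell n x y
  · by_cases h₂ : D.SameCell n y z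
    · simp [psi, h₁, h₂, SameCell.trans' D h₁ h₂]
    · have : D.psi n y z = 1 := if_neg h₂
      linarith [D.psi_le_one n x z, D.psi_nonneg n x y]
  · have : D.psi n x y = 1 := if_neg h₁
    linarith [D.psi_le_one n x z, D.psi_nonneg n y z]

theorem eq_of_rho_eq_zero {x y : X} (h : D.rho x y = 0) : x = y := by
  have hz : ∀ n : ℕ+, D.SameCell n x y := fun n => by
    by_contra hn
    have h1 : D.psi n x y = 1 := if_neg hn
    have h2 := (D.summable_rho x y).le_tsum n
      (fun m _ => div_nonneg (D.psi_nonneg m x y) (by positivity))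
    have h3 : (0 : ℝ) < D.psi n x y / 2 ^ (n : ℕ) := by rw [h1]; positivity
    unfold rho at h
    linarith
  choose i hx hy using hz
  exact D.separate i (Set.mem_iInter.2 hx) (Set.mem_iInter.2 hy)

/-- The metric space `(X, ρ)`. -/
@[reducible] def metricSpace : MetricSpace X where
  dist := D.rho
  dist_self := D.rho_self
  dist_comm := D.rho_comm
  dist_triangle := D.rho_triangle
  eq_of_dist_eq_zero := D.eq_of_rho_eq_zero

variable (Δ : MeasureTheory.AddContent ℝ≥0 D.algebra)

/-- The measure density `ν*(S) = inf {Δ(A) : A ∈ 𝓓_0, S ⊆ A}`. -/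
def measureDensity (S : Set X) : ℝ :=
  sInf {r : ℝ | ∃ A ∈ D.algebra, S ⊆ A ∧ r = (Δ A : ℝ)}

/-- The `ν*`-measurable sets, i.e. the members of `𝓓_ν`. -/
def DensityMeasurable (S : Set X) : Prop :=
  D.measureDensity Δ S + D.measureDensity Δ Sᶜ = 1

/-- `g` preserves the measure density: it maps each `ν*`-measurable set to a `ν*`-measurable set
of the same measure. -/
def PreservesDensity (g : X → X) : Prop :=
  ∀ S : Set X, D.DensityMeasurable Δ S →
    D.DensityMeasurable Δ (g '' S) ∧ D.measureDensity Δ (g '' S) = D.measureDensity Δ S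

/-- `ν*`-Buck uniformly distributed sequences: for every `ν*`-measurable set `S`, the set
`A(S, {x_n}) = {n : x_n ∈ S}` is Buck measurable and its Buck measure is `ν(S)`. -/
def IsBUD (x : ℕ+ → X) : Prop :=
  ∀ S : Set X, D.DensityMeasurable Δ S →
    BuckMeasurable {n | x n ∈ S} ∧ buckDensity {n | x n ∈ S} = D.measureDensity Δ S

end DecompositionSystem

end

open scoped NNReal

noncomputable section

/-! ### Buck's measure density -/

/-! Both densities are infima over covers and satisfy `μ*(S) + μ*(Sᶜ) ≥ 1`, `ν*(S) + ν*(Sᶜ) ≥ 1`. An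
upper bound proved for every set, hence for a measurable set and its complement, is therefore an
equality on measurable sets, and it is enough to check upper bounds on `𝓓_0`.

If `g` preserves the density, pulling any B.u.d. sequence back by `g⁻¹` gives another, since
`g⁻¹(x_n) ∈ S` iff `x_n ∈ g(S)`; what has to be built is one B.u.d. sequence (`exists_isBUD`). Order
the cells of the first `n` decompositions lexicographically and cut `[0,1)` into consecutive
intervals of lengths given by `Δ`. Let `x_n` be a point whose level-`n` interval contains the `n`-th
van der Corput number. Intervals refine as the level grows, so for `n ≥ k` the level-`k` cell of
`x_n` is dictated by that number, and the van der Corput sequence visits an interval with Buck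
density at most its length.

Conversely, uniform continuity of `g⁻¹` makes `g(A) = (g⁻¹)⁻¹(A)` lie in `𝓓_0` for `A ∈ 𝓓_0`. The
two sequences then compute `Δ(g(A))` and `Δ(A)` as the Buck density of one and the same index set.
-/

theorem bddBelow_buckDensity (S : Set ℕ+) :
    BddBelow {r : ℝ | ∃ (n : ℕ) (a : Fin n → ℕ) (m : Fin n → ℕ+),
      S ⊆ ⋃ k, arithProg (a k) (m k) ∧ r = ∑ k, 1 / ((m k : ℕ) : ℝ)} := by
  refine ⟨0, ?_⟩
  rintro r ⟨n, a, m, -, rfl⟩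
  positivity

theorem buckDensity_le_of_cover {ι : Type*} [Fintype ι] {S : Set ℕ+} (a : ι → ℕ) (m : ι → ℕ+)
    (h : S ⊆ ⋃ k, arithProg (a k) (m k)) : buckDensity S ≤ ∑ k, 1 / ((m k : ℕ) : ℝ) := by
  refine csInf_le (bddBelow_buckDensity S)
    ⟨Fintype.card ι, a ∘ (Fintype.equivFin ι).symm, m ∘ (Fintype.equivFin ι).symm, ?_, ?_⟩
  · intro x hx
    obtain ⟨k, hk⟩ := Set.mem_iUnion.1 (h hx)
    exact Set.mem_iUnion.2 ⟨Fintype.equivFin ι k, by simpa using hk⟩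
  · exact ((Fintype.equivFin ι).symm.sum_comp fun k => 1 / ((m k : ℕ) : ℝ)).symm

theorem exists_cover_lt_buckDensity_add (S : Set ℕ+) {ε : ℝ} (hε : 0 < ε) :
    ∃ (n : ℕ) (a : Fin n → ℕ) (m : Fin n → ℕ+),
      S ⊆ ⋃ k, arithProg (a k) (m k) ∧ ∑ k, 1 / ((m k : ℕ) : ℝ) < buckDensity S + ε := by
  have hne : {r : ℝ | ∃ (n : ℕ) (a : Fin n → ℕ) (m : Fin n → ℕ+),
      S ⊆ ⋃ k, arithProg (a k) (m k) ∧ r = ∑ k, 1 / ((m k : ℕ) : ℝ)}.Nonempty := by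
    refine ⟨_, 1, fun _ => 0, fun _ => 1, fun x _ => ?_, rfl⟩
    exact Set.mem_iUnion.2 ⟨0, Nat.modEq_one⟩
  obtain ⟨r, ⟨n, a, m, hS, rfl⟩, hr⟩ := exists_lt_of_csInf_lt hne (lt_add_of_pos_right _ hε)
  exact ⟨n, a, m, hS, hr⟩

theorem buckDensity_mono {S T : Set ℕ+} (h : S ⊆ T) : buckDensity S ≤ buckDensity T := by
  refine le_of_forall_pos_le_add fun ε hε => ?_
  obtain ⟨n, a, m, hT, hlt⟩ := exists_cover_lt_buckDensity_add T hε
  exact (buckDensity_le_of_cover a m (h.trans hT)).trans hlt.le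

theorem buckDensity_union_le (S T : Set ℕ+) :
    buckDensity (S ∪ T) ≤ buckDensity S + buckDensity T := by
  refine le_of_forall_pos_le_add fun ε hε => ?_
  obtain ⟨n, a, m, hS, hlt⟩ := exists_cover_lt_buckDensity_add S (half_pos hε)
  obtain ⟨n', a', m', hT, hlt'⟩ := exists_cover_lt_buckDensity_add T (half_pos hε)
  have h := buckDensity_le_of_cover (S := S ∪ T) (Sum.elim a a') (Sum.elim m m') <| by
    rw [Set.iUnion_sum]
    exact Set.union_subset_union hS hT
  simp only [Fintype.sum_sum_type, Sum.elim_inl, Sum.elim_inr] at h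
  linarith

theorem buckDensity_nonpos_of_finite {S : Set ℕ+} (hS : S.Finite) : buckDensity S ≤ 0 := by
  induction S, hS using Set.Finite.induction_on with
  | empty => simpa using buckDensity_le_of_cover (S := ∅) (Fin.elim0) (Fin.elim0) (by simp)
  | @insert x S _ _ ih =>
    have hx : buckDensity {x} ≤ 0 := by
      refine le_of_forall_pos_le_add fun ε hε => ?_
      obtain ⟨n, hn⟩ := exists_nat_one_div_lt hε
      have h := buckDensity_le_of_cover (S := {x}) (ι := Unit) (fun _ => x) (fun _ => n.succPNat)
        (by rintro y rfl; exact Set.mem_iUnion.2 ⟨(), Nat.ModEq.refl _⟩)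
      simp only [Finset.univ_unique, Finset.sum_singleton, Nat.succPNat_coe,
        Nat.succ_eq_add_one, Nat.cast_add, Nat.cast_one] at h
      linarith
    rw [Set.insert_eq]
    linarith [buckDensity_union_le {x} S]

theorem buckDensity_biUnion_le {ι : Type*} (J : Finset ι) (S : ι → Set ℕ+) :
    buckDensity (⋃ j ∈ J, S j) ≤ ∑ j ∈ J, buckDensity (S j) := by
  classical
  induction J using Finset.induction_on with
  | empty => simpa using buckDensity_nonpos_of_finite Set.finite_empty
  | insert j J hj ih =>
    rw [Finset.set_biUnion_insert, Finset.sum_insert hj]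
    linarith [buckDensity_union_le (S j) (⋃ i ∈ J, S i)]

theorem card_filter_modEq_mul (a m c : ℕ) (hm : 0 < m) :
    ((Finset.Ioc 0 (m * c)).filter (· ≡ a [MOD m])).card = c := by
  have h := Nat.Ioc_filter_modEq_card 0 (m * c) hm a
  have hm' : (m : ℚ) ≠ 0 := by positivity
  -- The count is a difference of two floors whose arguments differ by exactly `c`.
  have e : ((m * c : ℕ) - (a : ℚ)) / m = ((0 : ℕ) - (a : ℚ)) / m + (c : ℕ) := by
    push_cast
    field_simp
    ring
  rw [e, Int.floor_add_natCast, add_sub_cancel_left] at h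
  simpa using h

/-- Count over one common period `N`: the `k`-th progression contains exactly `N / m k` of the
numbers `1, …, N`. -/
theorem one_le_sum_of_cover_univ {n : ℕ} (a : Fin n → ℕ) (m : Fin n → ℕ+)
    (h : (Set.univ : Set ℕ+) ⊆ ⋃ k, arithProg (a k) (m k)) :
    1 ≤ ∑ k, 1 / ((m k : ℕ) : ℝ) := by
  set N : ℕ := ∏ k, (m k : ℕ) with hN
  have hNpos : 0 < N := Finset.prod_pos fun k _ => (m k).pos
  have hsub : Finset.Ioc 0 N ⊆
      Finset.univ.biUnion fun k => (Finset.Ioc 0 N).filter (· ≡ a k [MOD m k]) := by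
    intro y hy
    obtain ⟨k, hk⟩ := Set.mem_iUnion.1 (h (Set.mem_univ ⟨y, (Finset.mem_Ioc.1 hy).1⟩))
    exact Finset.mem_biUnion.2 ⟨k, Finset.mem_univ _, Finset.mem_filter.2 ⟨hy, hk⟩⟩
  have hcard := (Finset.card_le_card hsub).trans Finset.card_biUnion_le
  rw [Nat.card_Ioc, Nat.sub_zero] at hcard
  have hk : ∀ k, ((((Finset.Ioc 0 N).filter (· ≡ a k [MOD m k])).card : ℕ) : ℝ)
      = N * (1 / ((m k : ℕ) : ℝ)) := fun k => by
    obtain ⟨c, hc⟩ : (m k : ℕ) ∣ N := Finset.dvd_prod_of_mem _ (Finset.mem_univ k)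
    have hm : ((m k : ℕ) : ℝ) ≠ 0 := by exact_mod_cast (m k).pos.ne'
    rw [hc, card_filter_modEq_mul _ _ _ (m k).pos]
    push_cast
    field_simp
  have hcard' : (N : ℝ) ≤ ∑ k, N * (1 / ((m k : ℕ) : ℝ)) := by
    simp_rw [← hk]
    exact_mod_cast hcard
  rw [← Finset.mul_sum] at hcard'
  have : (0 : ℝ) < N := by exact_mod_cast hNpos
  exact le_of_mul_le_mul_left (by linarith) this

theorem one_le_buckDensity_add_compl (S : Set ℕ+) : 1 ≤ buckDensity S + buckDensity Sᶜ := by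
  refine le_trans ?_ (buckDensity_union_le S Sᶜ)
  rw [Set.union_compl_self]
  refine le_of_forall_pos_le_add fun ε hε => ?_
  obtain ⟨n, a, m, hS, hlt⟩ := exists_cover_lt_buckDensity_add Set.univ hε
  exact (one_le_sum_of_cover_univ a m hS).trans hlt.le

/-! ### The binary van der Corput sequence -/

/-- The number whose `k` binary digits are the last `k` binary digits of `n` in reverse order. -/
def bitReverse : ℕ → ℕ → ℕ
  | 0, _ => 0
  | k + 1, n => 2 * bitReverse k n + n / 2 ^ k % 2

theorem modEq_of_bitReverse_eq {k n n' : ℕ} (h : bitReverse k n = bitReverse k n') :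
    n ≡ n' [MOD 2 ^ k] := by
  induction k with
  | zero => exact Nat.modEq_one
  | succ k ih =>
    simp only [bitReverse] at h
    have h₁ : n % 2 ^ k = n' % 2 ^ k := ih (by omega)
    have h₂ : n / 2 ^ k % 2 = n' / 2 ^ k % 2 := by omega
    rw [Nat.ModEq, Nat.mod_pow_succ, Nat.mod_pow_succ, h₁, h₂]

/-- Reading `j` more digits of `n` only appends `j` low-order digits to the reversal. -/
theorem bitReverse_bounds (k j n : ℕ) :
    bitReverse k n * 2 ^ j ≤ bitReverse (k + j) n ∧
      bitReverse (k + j) n < (bitReverse k n + 1) * 2 ^ j := by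
  induction j with
  | zero => simp
  | succ j ih =>
    rw [← add_assoc]
    simp only [bitReverse, pow_succ, ← mul_assoc]
    have := Nat.mod_lt (n / 2 ^ (k + j)) two_pos
    omega

/-- The `n`-th term of the binary van der Corput sequence. -/
def vanDerCorput (n : ℕ) : ℝ := bitReverse n n / 2 ^ n

theorem floor_two_pow_mul_vanDerCorput {k n : ℕ} (h : k ≤ n) :
    ⌊2 ^ k * vanDerCorput n⌋₊ = bitReverse k n := by
  obtain ⟨j, rfl⟩ := Nat.exists_eq_add_of_le h
  obtain ⟨h₁, h₂⟩ := bitReverse_bounds k j (k + j)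
  have h₁' : (bitReverse k (k + j) * 2 ^ j : ℝ) ≤ bitReverse (k + j) (k + j) := by
    exact_mod_cast h₁
  have h₂' : (bitReverse (k + j) (k + j) : ℝ) < (bitReverse k (k + j) + 1) * 2 ^ j := by
    exact_mod_cast h₂
  have e : 2 ^ k * vanDerCorput (k + j) = bitReverse (k + j) (k + j) / 2 ^ j := by
    rw [vanDerCorput, pow_add]
    field_simp
  rw [e, Nat.floor_eq_iff (by positivity)]
  exact ⟨(le_div_iff₀ (by positivity)).2 h₁', (div_lt_iff₀ (by positivity)).2 h₂'⟩

theorem vanDerCorput_nonneg (n : ℕ) : 0 ≤ vanDerCorput n := by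
  unfold vanDerCorput
  positivity

theorem vanDerCorput_lt_one (n : ℕ) : vanDerCorput n < 1 := by
  have h := floor_two_pow_mul_vanDerCorput n.zero_le
  rw [bitReverse, pow_zero, one_mul] at h
  exact Nat.floor_eq_zero.1 h

theorem buckDensity_bitReverse_mem_le (k : ℕ) (J : Finset ℕ) :
    buckDensity {n : ℕ+ | bitReverse k n ∈ J} ≤ J.card / 2 ^ k := by
  have h : ∀ j : J, ∃ a : ℕ, ∀ n : ℕ+, bitReverse k n = j →
      n ∈ arithProg a ⟨2 ^ k, by positivity⟩ := fun j => by
      by_cases hj : ∃ a, bitReverse k a = j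
      · obtain ⟨a, ha⟩ := hj
        exact ⟨a, fun n hn => modEq_of_bitReverse_eq (hn.trans ha.symm)⟩
      -- `J` may contain values that are never attained; any progression serves for them.
      · exact ⟨0, fun n hn => (hj ⟨n, hn⟩).elim⟩
  choose a ha using h
  refine (buckDensity_le_of_cover a (fun _ => ⟨2 ^ k, by positivity⟩) fun n hn => ?_).trans_eq ?_
  · exact Set.mem_iUnion.2 ⟨⟨_, hn⟩, ha ⟨_, hn⟩ n rfl⟩
  · simp [div_eq_mul_inv]

/-- Cover `[a, b)` by dyadic intervals of length `2⁻ᵏ`, each of which costs one residue class mod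
`2ᵏ`. The two ends waste at most `2 · 2⁻ᵏ < ε`, and the finitely many `n < k` have density zero. -/
theorem buckDensity_vanDerCorput_mem_Ico_le {a b : ℝ} (ha : 0 ≤ a) (hab : a ≤ b) :
    buckDensity {n : ℕ+ | vanDerCorput n ∈ Set.Ico a b} ≤ b - a := by
  refine le_of_forall_pos_le_add fun ε hε => ?_
  obtain ⟨k, hk⟩ := exists_pow_lt_of_lt_one (half_pos hε) (one_half_lt_one (α := ℝ))
  set J := Finset.Icc ⌊2 ^ k * a⌋₊ ⌊2 ^ k * b⌋₊ with hJ
  have hsub : {n : ℕ+ | vanDerCorput n ∈ Set.Ico a b} ⊆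
      {n : ℕ+ | (n : ℕ) < k} ∪ {n : ℕ+ | bitReverse k n ∈ J} := by
    intro n hn
    rcases lt_or_ge (n : ℕ) k with h | h
    · exact Or.inl h
    · refine Or.inr ?_
      rw [Set.mem_ofPred_eq, ← floor_two_pow_mul_vanDerCorput h, hJ, Finset.mem_Icc]
      exact ⟨Nat.floor_mono (mul_le_mul_of_nonneg_left hn.1 (by positivity)),
        Nat.floor_mono (mul_le_mul_of_nonneg_left hn.2.le (by positivity))⟩
  have hfin : {n : ℕ+ | (n : ℕ) < k}.Finite :=
    (Set.finite_lt_nat k).preimage PNat.coe_injective.injOn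
  have hcard : (J.card : ℝ) ≤ 2 ^ k * (b - a) + 2 := by
    have h₁ : ⌊2 ^ k * a⌋₊ ≤ ⌊2 ^ k * b⌋₊ + 1 :=
      (Nat.floor_mono (mul_le_mul_of_nonneg_left hab (by positivity))).trans (Nat.le_succ _)
    have h₂ := Nat.floor_le (show 0 ≤ 2 ^ k * b by have := ha.trans hab; positivity)
    have h₃ := Nat.lt_floor_add_one (2 ^ k * a)
    rw [hJ, Nat.card_Icc, Nat.cast_sub h₁]
    push_cast
    linarith
  have hle : (J.card : ℝ) / 2 ^ k ≤ b - a + 2 * (1 / 2) ^ k := by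
    rw [div_le_iff₀ (by positivity), one_div, inv_pow, add_mul, mul_assoc,
      inv_mul_cancel₀ (by positivity)]
    linarith
  linarith [buckDensity_mono hsub, buckDensity_nonpos_of_finite hfin, buckDensity_bitReverse_mem_le k J,
    buckDensity_union_le {n : ℕ+ | (n : ℕ) < k} {n : ℕ+ | bitReverse k n ∈ J}]

namespace DecompositionSystem

/-! ### The algebra `𝓓_0` -/

section Algebra

variable {X : Type*} (D : DecompositionSystem X)

/-- The index of the cell of the `n`-th decomposition that contains `x`. -/
def idx (n : ℕ+) (x : X) : Fin (D.size n) := (D.exists_cell n x).choose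

theorem mem_cell_iff {n : ℕ+} {i : Fin (D.size n)} {x : X} : x ∈ D.cell n i ↔ D.idx n x = i := by
  have hx : x ∈ D.cell n (D.idx n x) := (D.exists_cell n x).choose_spec
  refine ⟨fun h => ?_, fun h => h ▸ hx⟩
  by_contra hne
  have h' : x ∈ D.cell n (D.idx n x) ∩ D.cell n i := ⟨hx, h⟩
  rw [D.disjoint n _ _ hne] at h'
  exact h'

theorem sameCell_iff {n : ℕ+} {x y : X} : D.SameCell n x y ↔ D.idx n x = D.idx n y := by
  simp only [SameCell, mem_cell_iff]
  exact ⟨fun ⟨_, h, h'⟩ => h.trans h'.symm, fun h => ⟨_, h, rfl⟩⟩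

theorem mem_iff_of_idx_eq {s : ℕ+} {A : Set X} {T : Finset (Fin (D.size s))}
    (hA : A = ⋃ i ∈ T, D.cell s i) {x y : X} (h : D.idx s x = D.idx s y) : x ∈ A ↔ y ∈ A := by
  simp only [hA, Set.mem_iUnion, mem_cell_iff, h]

theorem exists_common_refinement (N : Finset ℕ+) :
    ∃ s, ∀ n ∈ N, ∀ x y, D.idx s x = D.idx s y → D.idx n x = D.idx n y := by
  obtain ⟨s, hs⟩ := D.refinement (N.sigma fun _ => Finset.univ)
  refine ⟨s, fun n hn x y h => ?_⟩
  obtain ⟨T, hT⟩ := hs ⟨n, D.idx n y⟩ (by simpa using hn)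
  exact D.mem_cell_iff.1 ((D.mem_iff_of_idx_eq hT h).2 (D.mem_cell_iff.2 rfl))

/-- Finitely many cells have a common refinement, so the algebra consists of the sets saturated for
a single decomposition. -/
theorem mem_algebra_iff {A : Set X} :
    A ∈ D.algebra ↔ ∃ s, ∀ x y, D.idx s x = D.idx s y → (x ∈ A ↔ y ∈ A) := by
  classical
  constructor
  · rintro ⟨F, rfl⟩
    obtain ⟨s, hs⟩ := D.exists_common_refinement (F.image Sigma.fst)
    refine ⟨s, fun x y h => ?_⟩
    simp only [Set.mem_iUnion, mem_cell_iff]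
    refine exists_congr fun p => exists_congr fun hp => ?_
    rw [hs p.1 (Finset.mem_image_of_mem _ hp) x y h]
  · rintro ⟨s, hs⟩
    refine ⟨(Finset.univ.filter fun i => ∃ x ∈ A, D.idx s x = i).map
      ⟨Sigma.mk s, sigma_mk_injective⟩, ?_⟩
    ext y
    simp only [Finset.mem_map, Finset.mem_filter, Finset.mem_univ, true_and,
      Function.Embedding.coeFn_mk, Set.mem_iUnion, exists_prop]
    constructor
    · exact fun hy => ⟨_, ⟨_, ⟨y, hy, rfl⟩, rfl⟩, D.mem_cell_iff.2 rfl⟩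
    · rintro ⟨_, ⟨_, ⟨x, hx, rfl⟩, rfl⟩, h⟩
      exact (hs y x (D.mem_cell_iff.1 h)).2 hx

theorem compl_mem_algebra {A : Set X} (hA : A ∈ D.algebra) : Aᶜ ∈ D.algebra := by
  obtain ⟨s, hs⟩ := D.mem_algebra_iff.1 hA
  exact D.mem_algebra_iff.2 ⟨s, fun x y h => not_congr (hs x y h)⟩

theorem univ_mem_algebra : Set.univ ∈ D.algebra :=
  D.mem_algebra_iff.2 ⟨1, fun _ _ _ => Iff.rfl⟩

theorem union_mem_algebra {A B : Set X} (hA : A ∈ D.algebra) (hB : B ∈ D.algebra) :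
    A ∪ B ∈ D.algebra := by
  obtain ⟨s, hs⟩ := D.mem_algebra_iff.1 hA
  obtain ⟨t, ht⟩ := D.mem_algebra_iff.1 hB
  obtain ⟨r, hr⟩ := D.exists_common_refinement {s, t}
  exact D.mem_algebra_iff.2 ⟨r, fun x y h => or_congr (hs x y (hr s (by simp) x y h))
    (ht x y (hr t (by simp) x y h))⟩

theorem isSetRing_algebra : MeasureTheory.IsSetRing D.algebra where
  empty_mem := by simpa using D.compl_mem_algebra D.univ_mem_algebra
  union_mem _ _ := D.union_mem_algebra
  sdiff_mem A B hA hB := by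
    have h : A \ B = (Aᶜ ∪ B)ᶜ := by rw [Set.compl_union, compl_compl, Set.sdiff_eq]
    exact h ▸ D.compl_mem_algebra (D.union_mem_algebra (D.compl_mem_algebra hA) hB)

end Algebra

/-! ### The measure density -/

section Density

variable {X : Type*} {D : DecompositionSystem X} {Δ : MeasureTheory.AddContent ℝ≥0 D.algebra}

theorem content_mono {A B : Set X} (hA : A ∈ D.algebra) (hB : B ∈ D.algebra) (h : A ⊆ B) :
    (Δ A : ℝ) ≤ Δ B :=
  NNReal.coe_le_coe.2 (MeasureTheory.addContent_mono D.isSetRing_algebra.isSetSemiring hA hB h)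

theorem content_union_le {A B : Set X} (hA : A ∈ D.algebra) (hB : B ∈ D.algebra) :
    (Δ (A ∪ B) : ℝ) ≤ Δ A + Δ B := by
  exact_mod_cast MeasureTheory.addContent_union_le D.isSetRing_algebra hA hB

theorem content_add_compl (hΔ : Δ Set.univ = 1) {A : Set X} (hA : A ∈ D.algebra) :
    (Δ A : ℝ) + Δ Aᶜ = 1 := by
  have h := MeasureTheory.addContent_union (m := Δ) D.isSetRing_algebra hA
    (D.compl_mem_algebra hA) disjoint_compl_right
  rw [Set.union_compl_self, hΔ] at h
  exact_mod_cast h.symm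

theorem measureDensity_le {S A : Set X} (hA : A ∈ D.algebra) (h : S ⊆ A) :
    D.measureDensity Δ S ≤ Δ A := by
  refine csInf_le ⟨0, ?_⟩ ⟨A, hA, h, rfl⟩
  rintro r ⟨B, -, -, rfl⟩
  exact NNReal.coe_nonneg _

theorem exists_content_lt_measureDensity_add (S : Set X) {ε : ℝ} (hε : 0 < ε) :
    ∃ A ∈ D.algebra, S ⊆ A ∧ (Δ A : ℝ) < D.measureDensity Δ S + ε := by
  have hne : {r : ℝ | ∃ A ∈ D.algebra, S ⊆ A ∧ r = (Δ A : ℝ)}.Nonempty :=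
    ⟨_, Set.univ, D.univ_mem_algebra, S.subset_univ, rfl⟩
  obtain ⟨r, ⟨A, hA, hS, rfl⟩, hr⟩ := exists_lt_of_csInf_lt hne (lt_add_of_pos_right _ hε)
  exact ⟨A, hA, hS, hr⟩

theorem measureDensity_eq_content {A : Set X} (hA : A ∈ D.algebra) :
    D.measureDensity Δ A = Δ A := by
  refine le_antisymm (measureDensity_le hA subset_rfl) (le_of_forall_pos_le_add fun ε hε => ?_)
  obtain ⟨B, hB, hAB, hlt⟩ := exists_content_lt_measureDensity_add (D := D) (Δ := Δ) A hε
  exact (content_mono hA hB hAB).trans hlt.le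

theorem densityMeasurable_of_mem_algebra (hΔ : Δ Set.univ = 1) {A : Set X} (hA : A ∈ D.algebra) :
    D.DensityMeasurable Δ A := by
  rw [DensityMeasurable, measureDensity_eq_content hA,
    measureDensity_eq_content (D.compl_mem_algebra hA), content_add_compl hΔ hA]

theorem one_le_measureDensity_add_compl (hΔ : Δ Set.univ = 1) (S : Set X) :
    1 ≤ D.measureDensity Δ S + D.measureDensity Δ Sᶜ := by
  refine le_of_forall_pos_le_add fun ε hε => ?_
  obtain ⟨A, hA, hSA, hlt⟩ := exists_content_lt_measureDensity_add (D := D) (Δ := Δ) S (half_pos hε)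
  obtain ⟨B, hB, hSB, hlt'⟩ :=
    exists_content_lt_measureDensity_add (D := D) (Δ := Δ) Sᶜ (half_pos hε)
  have huniv : A ∪ B = Set.univ :=
    Set.univ_subset_iff.1 ((Set.union_compl_self S).symm.subset.trans
      (Set.union_subset_union hSA hSB))
  have h := content_union_le (Δ := Δ) hA hB
  rw [huniv, hΔ, NNReal.coe_one] at h
  linarith

theorem isBUD_of_forall_mem_algebra {x : ℕ+ → X}
    (h : ∀ A ∈ D.algebra, buckDensity {n | x n ∈ A} ≤ Δ A) : D.IsBUD Δ x := by
  have hle : ∀ S : Set X, buckDensity {n | x n ∈ S} ≤ D.measureDensity Δ S := fun S => by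
    refine le_of_forall_pos_le_add fun ε hε => ?_
    obtain ⟨A, hA, hSA, hlt⟩ := exists_content_lt_measureDensity_add (D := D) (Δ := Δ) S hε
    exact (buckDensity_mono fun n hn => hSA hn).trans ((h A hA).trans hlt.le)
  intro S hS
  have h₁ := hle S
  have h₂ : buckDensity {n | x n ∈ S}ᶜ ≤ D.measureDensity Δ Sᶜ := hle Sᶜ
  have h₃ := one_le_buckDensity_add_compl {n | x n ∈ S}
  unfold DensityMeasurable at hS
  exact ⟨by unfold BuckMeasurable; linarith, by linarith⟩

theorem preservesDensity_of_forall_mem_algebra (hΔ : Δ Set.univ = 1) (g : X ≃ X)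
    (h : ∀ A ∈ D.algebra, g '' A ∈ D.algebra ∧ Δ (g '' A) = Δ A) : D.PreservesDensity Δ g := by
  have hle : ∀ S : Set X, D.measureDensity Δ (g '' S) ≤ D.measureDensity Δ S := fun S => by
    refine le_of_forall_pos_le_add fun ε hε => ?_
    obtain ⟨A, hA, hSA, hlt⟩ := exists_content_lt_measureDensity_add (D := D) (Δ := Δ) S hε
    obtain ⟨hgA, heq⟩ := h A hA
    refine (measureDensity_le hgA (Set.image_mono hSA)).trans ?_
    rw [heq]
    exact hlt.le
  intro S hS
  have h₁ := hle S
  have h₂ := hle Sᶜ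
  rw [Set.image_compl_eq g.bijective] at h₂
  have h₃ := one_le_measureDensity_add_compl hΔ (g '' S)
  unfold DensityMeasurable at hS ⊢
  exact ⟨by linarith, by linarith⟩

end Density

/-! ### Uniformly continuous maps -/

section UniformContinuity

variable {X : Type*} (D : DecompositionSystem X)

theorem idx_eq_of_rho_lt {s : ℕ+} {x y : X} (h : D.rho x y < 1 / 2 ^ (s : ℕ)) :
    D.idx s x = D.idx s y := by
  by_contra hne
  have h₁ : D.psi s x y = 1 := if_neg fun h => hne (D.sameCell_iff.1 h)
  have h₂ := (D.summable_rho x y).le_tsum s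
    (fun m _ => div_nonneg (D.psi_nonneg m x y) (by positivity))
  rw [h₁] at h₂
  exact h.not_ge h₂

/-- Choose a finite head with geometric tail below `δ`; a common refinement of the head makes all
its terms vanish. -/
theorem exists_rho_lt_of_idx_eq {δ : ℝ} (hδ : 0 < δ) :
    ∃ r, ∀ x y, D.idx r x = D.idx r y → D.rho x y < δ := by
  have hg : Summable fun n : ℕ+ => ((1 : ℝ) / 2) ^ (n : ℕ) :=
    summable_geometric_two.comp_injective PNat.coe_injective
  obtain ⟨N, hN⟩ := ((tendsto_order.1 (tendsto_tsum_compl_atTop_zero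
    fun n : ℕ+ => ((1 : ℝ) / 2) ^ (n : ℕ))).2 δ hδ).exists
  obtain ⟨r, hr⟩ := D.exists_common_refinement N
  refine ⟨r, fun x y h => lt_of_le_of_lt ?_ hN⟩
  have hzero : ∑ n ∈ N, D.psi n x y / 2 ^ (n : ℕ) = 0 := Finset.sum_eq_zero fun n hn => by
    rw [psi, if_pos (D.sameCell_iff.2 (hr n hn x y h)), zero_div]
  rw [rho, ← (D.summable_rho x y).sum_add_tsum_compl (s := N), hzero, zero_add]
  refine ((D.summable_rho x y).subtype _).tsum_le_tsum (fun n => ?_) (hg.subtype _)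
  rw [one_div, inv_pow, div_eq_mul_inv]
  exact mul_le_of_le_one_left (by positivity) (D.psi_le_one _ x y)

theorem preimage_mem_algebra {f : X → X}
    (hf : letI : MetricSpace X := D.metricSpace; UniformContinuous f) {A : Set X}
    (hA : A ∈ D.algebra) : f ⁻¹' A ∈ D.algebra := by
  let _ : MetricSpace X := D.metricSpace
  obtain ⟨s, hs⟩ := D.mem_algebra_iff.1 hA
  obtain ⟨δ, hδ, h⟩ := Metric.uniformContinuous_iff.1 hf (1 / 2 ^ (s : ℕ)) (by positivity)
  obtain ⟨r, hr⟩ := D.exists_rho_lt_of_idx_eq hδ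
  exact D.mem_algebra_iff.2 ⟨r, fun x y hxy => hs _ _ (D.idx_eq_of_rho_lt (h (hr x y hxy)))⟩

end UniformContinuity

/-! ### Existence of uniformly distributed sequences -/

section Existence

variable {X : Type*} (D : DecompositionSystem X)

/-- An integer encoding, in lexicographic order, of the indices of the cells of the first `n`
decompositions that contain a point. -/
def code : ℕ → X → ℕ
  | 0, _ => 0
  | n + 1, x => code n x * D.size n.succPNat + D.idx n.succPNat x

/-- The new digit is smaller than its base, so it cannot overturn an earlier strict inequality. -/
theorem code_succ_lt {n : ℕ} {x y : X} (h : D.code n x < D.code n y) :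
    D.code (n + 1) x < D.code (n + 1) y := by
  simp only [code]
  have h₁ := (D.idx n.succPNat x).isLt
  have h₂ := Nat.mul_le_mul_right (D.size n.succPNat) (Nat.succ_le_of_lt h)
  rw [Nat.succ_mul] at h₂
  omega

theorem code_lt_of_le {k n : ℕ} (hkn : k ≤ n) {x y : X} (h : D.code k x < D.code k y) :
    D.code n x < D.code n y := by
  induction n, hkn using Nat.le_induction with
  | base => exact h
  | succ n _ ih => exact D.code_succ_lt ih

theorem idx_eq_of_code_eq {n : ℕ} {x y : X} (h : D.code (n + 1) x = D.code (n + 1) y) :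
    D.idx n.succPNat x = D.idx n.succPNat y := by
  have h' : D.code n x = D.code n y := by
    rcases lt_trichotomy (D.code n x) (D.code n y) with hlt | heq | hlt
    · exact absurd h (D.code_succ_lt hlt).ne
    · exact heq
    · exact absurd h (D.code_succ_lt hlt).ne'
  simp only [code, h'] at h
  exact Fin.ext (by omega)

theorem exists_code_lt (n : ℕ) : ∃ M, ∀ x, D.code n x < M := by
  induction n with
  | zero => exact ⟨1, fun _ => Nat.one_pos⟩
  | succ n ih =>
    obtain ⟨M, hM⟩ := ih
    refine ⟨M * D.size n.succPNat, fun x => ?_⟩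
    have h₁ := (D.idx n.succPNat x).isLt
    have h₂ := Nat.mul_le_mul_right (D.size n.succPNat) (Nat.succ_le_of_lt (hM x))
    rw [Nat.succ_mul] at h₂
    simp only [code]
    omega

theorem exists_code_eq_of_idx_eq (n : ℕ) :
    ∃ s, ∀ x y, D.idx s x = D.idx s y → D.code n x = D.code n y := by
  induction n with
  | zero => exact ⟨1, fun _ _ _ => rfl⟩
  | succ n ih =>
    obtain ⟨s, hs⟩ := ih
    obtain ⟨r, hr⟩ := D.exists_common_refinement {s, n.succPNat}
    refine ⟨r, fun x y h => ?_⟩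
    simp only [code]
    rw [hs x y (hr s (by simp) x y h), hr n.succPNat (by simp) x y h]

theorem setOf_code_mem_algebra (n : ℕ) (P : ℕ → Prop) : {x | P (D.code n x)} ∈ D.algebra := by
  obtain ⟨s, hs⟩ := D.exists_code_eq_of_idx_eq n
  refine D.mem_algebra_iff.2 ⟨s, fun x y h => ?_⟩
  simp only [Set.mem_ofPred_eq, hs x y h]

theorem exists_eq_setOf_code_mem {A : Set X} (hA : A ∈ D.algebra) :
    ∃ (k : ℕ) (J : Finset ℕ), A = {x | D.code k x ∈ J} := by
  classical
  obtain ⟨s, hs⟩ := D.mem_algebra_iff.1 hA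
  obtain ⟨k, rfl⟩ : ∃ k : ℕ, k.succPNat = s := ⟨s.natPred, PNat.succPNat_natPred s⟩
  obtain ⟨M, hM⟩ := D.exists_code_lt (k + 1)
  refine ⟨k + 1, (Finset.range M).filter fun m => ∃ x ∈ A, D.code (k + 1) x = m, ?_⟩
  ext y
  simp only [Set.mem_ofPred_eq, Finset.mem_filter, Finset.mem_range, hM, true_and]
  exact ⟨fun hy => ⟨y, hy, rfl⟩,
    fun ⟨x, hx, hxy⟩ => (hs x y (D.idx_eq_of_code_eq hxy)).1 hx⟩

variable (Δ : MeasureTheory.AddContent ℝ≥0 D.algebra)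

/-- The distribution function of `code n`. -/
def codeCDF (n m : ℕ) : ℝ := Δ {x | D.code n x < m}

theorem codeCDF_nonneg (n m : ℕ) : 0 ≤ D.codeCDF Δ n m := NNReal.coe_nonneg _

theorem codeCDF_succ (n m : ℕ) :
    D.codeCDF Δ n (m + 1) = D.codeCDF Δ n m + Δ {x | D.code n x = m} := by
  have h := MeasureTheory.addContent_union (m := Δ) D.isSetRing_algebra
    (D.setOf_code_mem_algebra n (· < m)) (D.setOf_code_mem_algebra n (· = m))
    (Set.disjoint_left.2 fun x hx hx' => (Nat.ne_of_lt hx) hx')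
  have e : {x | D.code n x < m + 1} = {x | D.code n x < m} ∪ {x | D.code n x = m} := by
    ext x
    exact Nat.lt_succ_iff_lt_or_eq
  rw [codeCDF, codeCDF, e, h, NNReal.coe_add]

theorem codeCDF_mono (n : ℕ) : Monotone (D.codeCDF Δ n) :=
  monotone_nat_of_le_succ fun m => by
    rw [codeCDF_succ]
    exact le_add_of_nonneg_right (NNReal.coe_nonneg _)

theorem codeCDF_code_mono {k n : ℕ} (hkn : k ≤ n) (x : X) :
    D.codeCDF Δ k (D.code k x) ≤ D.codeCDF Δ n (D.code n x) :=
  content_mono (D.setOf_code_mem_algebra k (· < D.code k x))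
    (D.setOf_code_mem_algebra n (· < D.code n x)) fun _ hy => D.code_lt_of_le hkn hy

theorem codeCDF_code_succ_anti {k n : ℕ} (hkn : k ≤ n) (x : X) :
    D.codeCDF Δ n (D.code n x + 1) ≤ D.codeCDF Δ k (D.code k x + 1) :=
  content_mono (D.setOf_code_mem_algebra n (· < D.code n x + 1))
    (D.setOf_code_mem_algebra k (· < D.code k x + 1)) fun y (hy : D.code n y < D.code n x + 1) =>
      show D.code k y < D.code k x + 1 by
        by_contra h
        have := D.code_lt_of_le hkn (show D.code k x < D.code k y by omega)
        omega

variable {Δ}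

/-- A discrete quantile: at the least `m` where the distribution function exceeds `t`, it has just
jumped, so the code `m - 1` has positive content and is attained. -/
theorem exists_mem_Ico_codeCDF (hΔ : Δ Set.univ = 1) (n : ℕ) {t : ℝ} (ht : 0 ≤ t) (ht' : t < 1) :
    ∃ x, t ∈ Set.Ico (D.codeCDF Δ n (D.code n x)) (D.codeCDF Δ n (D.code n x + 1)) := by
  classical
  have hex : ∃ m, t < D.codeCDF Δ n m := by
    obtain ⟨M, hM⟩ := D.exists_code_lt n
    refine ⟨M, ?_⟩
    have e : {x | D.code n x < M} = Set.univ := Set.eq_univ_of_forall hM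
    rwa [codeCDF, e, hΔ, NNReal.coe_one]
  have hspec := Nat.find_spec hex
  have hmin : ∀ m < Nat.find hex, D.codeCDF Δ n m ≤ t := fun m hm => not_lt.1 (Nat.find_min hex hm)
  generalize Nat.find hex = m at hspec hmin
  cases m with
  | zero =>
    have e : {x | D.code n x < 0} = ∅ := by simp
    rw [codeCDF, e, MeasureTheory.addContent_empty, NNReal.coe_zero] at hspec
    exact absurd hspec ht.not_gt
  | succ m =>
    have hm := hmin m m.lt_succ_self
    have hne : {x | D.code n x = m}.Nonempty := by
      rw [Set.nonempty_iff_ne_empty]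
      intro h
      rw [codeCDF_succ, h, MeasureTheory.addContent_empty, NNReal.coe_zero, add_zero] at hspec
      exact absurd hm hspec.not_ge
    obtain ⟨x, rfl⟩ := hne
    exact ⟨x, hm, hspec⟩

theorem mem_Ico_codeCDF_of_le {k n : ℕ} (hkn : k ≤ n) {x : X} {t : ℝ}
    (ht : t ∈ Set.Ico (D.codeCDF Δ n (D.code n x)) (D.codeCDF Δ n (D.code n x + 1))) :
    t ∈ Set.Ico (D.codeCDF Δ k (D.code k x)) (D.codeCDF Δ k (D.code k x + 1)) :=
  ⟨(D.codeCDF_code_mono Δ hkn x).trans ht.1, ht.2.trans_le (D.codeCDF_code_succ_anti Δ hkn x)⟩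

theorem exists_isBUD (hΔ : Δ Set.univ = 1) : ∃ x, D.IsBUD Δ x := by
  -- The level grows with the index, so no point has to lie in an infinite intersection of cells,
  -- which might be empty.
  choose x hx using fun n : ℕ+ => D.exists_mem_Ico_codeCDF hΔ n (vanDerCorput_nonneg n)
    (vanDerCorput_lt_one n)
  refine ⟨x, isBUD_of_forall_mem_algebra fun A hA => ?_⟩
  obtain ⟨k, J, rfl⟩ := D.exists_eq_setOf_code_mem hA
  set I : ℕ → Set ℝ := fun m => Set.Ico (D.codeCDF Δ k m) (D.codeCDF Δ k (m + 1))
  have hsub : {n | x n ∈ {y | D.code k y ∈ J}} ⊆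
      {n : ℕ+ | (n : ℕ) < k} ∪ ⋃ m ∈ J, {n : ℕ+ | vanDerCorput n ∈ I m} := by
    intro n hn
    rcases lt_or_ge (n : ℕ) k with h | h
    · exact Or.inl h
    · exact Or.inr (Set.mem_biUnion hn (D.mem_Ico_codeCDF_of_le h (hx n)))
  have hfin : {n : ℕ+ | (n : ℕ) < k}.Finite :=
    (Set.finite_lt_nat k).preimage PNat.coe_injective.injOn
  have hI : ∀ m ∈ J, buckDensity {n : ℕ+ | vanDerCorput n ∈ I m} ≤ Δ {y | D.code k y = m} :=
    fun m _ => by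
      have h := buckDensity_vanDerCorput_mem_Ico_le (D.codeCDF_nonneg Δ k m)
        (D.codeCDF_mono Δ k m.le_succ)
      -- `codeCDF_succ` also rewrites the endpoint inside the set; the final reverse rewrite
      -- restores it.
      rwa [Nat.succ_eq_add_one, codeCDF_succ, add_sub_cancel_left, ← codeCDF_succ] at h
  have hsum : (Δ {y | D.code k y ∈ J} : ℝ) = ∑ m ∈ J, (Δ {y | D.code k y = m} : ℝ) := by
    have e : {y | D.code k y ∈ J} = ⋃ m ∈ J, {y | D.code k y = m} := by
      ext y
      simp
    rw [e, MeasureTheory.addContent_biUnion_eq D.isSetRing_algebra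
      (fun m _ => D.setOf_code_mem_algebra k (· = m)), NNReal.coe_sum]
    exact fun m _ m' _ hne => Set.disjoint_left.2 fun y hy hy' => hne (hy.symm.trans hy')
  rw [hsum]
  linarith [buckDensity_mono hsub, buckDensity_nonpos_of_finite hfin,
    buckDensity_union_le {n : ℕ+ | (n : ℕ) < k} (⋃ m ∈ J, {n : ℕ+ | vanDerCorput n ∈ I m}),
    buckDensity_biUnion_le J fun m => {n : ℕ+ | vanDerCorput n ∈ I m}, Finset.sum_le_sum hI]

end Existence

theorem PreservesDensity.isBUD_symm {X : Type*} {D : DecompositionSystem X}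
    {Δ : MeasureTheory.AddContent ℝ≥0 D.algebra} {g : X ≃ X} (hg : D.PreservesDensity Δ g)
    {x : ℕ+ → X} (hx : D.IsBUD Δ x) : D.IsBUD Δ fun n => g.symm (x n) := by
  intro S hS
  obtain ⟨hgS, heq⟩ := hg S hS
  have h := hx _ hgS
  rw [heq, g.image_eq_preimage_symm] at h
  exact h

end DecompositionSystem

end

theorem mainTheorem7 {X : Type*} (D : DecompositionSystem X)
    (Δ : MeasureTheory.AddContent ℝ≥0 D.algebra) (hΔ : Δ Set.univ = 1)
    (g : X ≃ X)
    (hg : letI : MetricSpace X := D.metricSpace; UniformContinuous (g.symm : X → X)) :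
    D.PreservesDensity Δ g ↔
      ∃ x : ℕ+ → X, D.IsBUD Δ x ∧ D.IsBUD Δ (fun n => g.symm (x n)) := by
  constructor
  · intro hpres
    obtain ⟨x, hx⟩ := D.exists_isBUD hΔ
    exact ⟨x, hx, hpres.isBUD_symm hx⟩
  · rintro ⟨x, hx, hgx⟩
    refine DecompositionSystem.preservesDensity_of_forall_mem_algebra hΔ g fun A hA => ?_
    have hgA : g '' A ∈ D.algebra := by
      rw [g.image_eq_preimage_symm]
      exact D.preimage_mem_algebra hg hA
    refine ⟨hgA, NNReal.coe_injective ?_⟩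
    -- Once `g '' A` is written as a preimage, `h₁` and `h₂` evaluate the Buck density of the same
    -- index set.
    have h₁ := (hx _ (DecompositionSystem.densityMeasurable_of_mem_algebra hΔ hgA)).2
    have h₂ := (hgx _ (DecompositionSystem.densityMeasurable_of_mem_algebra hΔ hA)).2
    rw [DecompositionSystem.measureDensity_eq_content hgA, g.image_eq_preimage_symm] at h₁
    rw [DecompositionSystem.measureDensity_eq_content hA] at h₂
    rw [g.image_eq_preimage_symm]
    exact h₁.symm.trans h₂
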